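/- Let $S\ge 0$ be an integer and let $p_0$ be a probability mass function on $\mathbb N=\{0,1,2,\dots\}$ with support exactly $\{0,\dots,S\}$ that is convex, i.e. $\Delta p_0(k):=p_0(k+1)-2p_0(k)+p_0(k-1)\ge 0$ for all $k\ge 1$. Let $X_1,X_2,\dots$ be i.i.d. with pmf $p_0$, let $p_n(j)=\frac1n\sum_{i=1}^n \mathbf 1\{X_i=j\}$ be the empirical pmf, and let $\widehat p_n$ be the convex least squares estimator, i.e. the unique minimizer of $\frac12\sum_{j\ge0}(p_n(j)-p(j))^2$ over all sequences $p=(p(j))_{j\ge 0}$ with $\sum_j p(j)^2<\infty$ and $\Delta p(k)\ge 0$ for all $k\ge1$. For a sequence $p$ put $F_p(k)=\sum_{j=0}^k p(j)$ (with $F_p(-1)=0$) and $H_p(z)=\sum_{k=0}^{z-1}F_p(k)$ (with $H_p(0)=0$). Let $\mathbb U$ be a standard Brownian bridge on $[0,1]$ and $\mathbb W(k)=\mathbb U(F_{p_0}(k))-\mathbb U(F_{p_0}(k-1))$ for $k=0,\dots,S+1$. Let $\mathcal K=\{k: 0<k<S+1,\ \Delta p_0(k)>0\}$ be the set of interior knots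 of $p_0$, and let $\mathcal C(\mathcal K)$ be the set of all $g=(g(0),\dots,g(S+1))\in\mathbb R^{S+2}$ that are convex between any two consecutive elements of $\mathcal K\cup\{0,S+1\}$, i.e. $g(k+1)-2g(k)+g(k-1)\ge0$ for all $k\in\{1,\dots,S\}\setminus\mathcal K$. Let $\widehat g$ be the unique minimizer of $\Phi(g)=\frac12\sum_{k=0}^{S+1}(g(k)-\mathbb W(k))^2$ over $g \in \mathcal C(\mathcal K)$, and put $\widehat{\mathbb G}(x)=\sum_{k=0}^x\widehat g(k)$ and $\widehat{\mathbb H}(x)=\sum_{k=0}^{x-1}\widehat{\mathbb G}(k)$ (so $\widehat{\mathbb H}(0)=0$) for $x\in\{0,\dots,S+1\}$. Then, jointly on $\{0,\dots,S+1\}$, i.e. as random elements of $(\mathbb R^{S+2})^3$, $$\bigl(\sqrt n(H_{\widehat p_n}-H_{p_0}),\ \sqrt n(F_{\widehat p_n}-F_{p_0}),\ \sqrt n(\widehat p_n-p_0)\bigr)\ \Rightarrow\ \bigl(\widehat{\mathbb H},\ \widehat{\mathbb G},\ \widehat g\bigr)\qquad\text{in distribution as } n\to\infty.$$ -/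

import Mathlib

open MeasureTheory ProbabilityTheory Filter Topology
open scoped ENNReal

namespace ConvexPmf

noncomputable section

/-! ### Sequences, distribution functions, convexity -/

/-- The cumulative sums `F_p(k) = ∑_{j ≤ k} p(j)`, for `p` indexed by `ℕ` or by `{0, …, N - 1}`. -/
def cumSum {ι : Type*} [Preorder ι] [LocallyFiniteOrderBot ι] (p : ι → ℝ) (k : ι) : ℝ :=
  ∑ j ∈ Finset.Iic k, p j

/-- The cumulative sums of the cumulative sums, `H_p(z) = ∑_{k < z} F_p(k)`; so `H_p(0) = 0`. -/
def cumCumSum {ι : Type*} [Preorder ι] [LocallyFiniteOrderBot ι] (p : ι → ℝ) (z : ι) : ℝ :=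
  ∑ k ∈ Finset.Iio z, cumSum p k

/-- `F_p(k - 1) = ∑_{j < k} p(j)`; in particular `F_p(-1) = 0`. -/
def cumSumPred (p : ℕ → ℝ) (k : ℕ) : ℝ :=
  ∑ j ∈ Finset.Iio k, p j

/-- The discrete Laplacian `Δp(k) = p(k+1) - 2p(k) + p(k-1)`; only used for `k ≥ 1`. -/
def laplacian (p : ℕ → ℝ) (k : ℕ) : ℝ :=
  p (k + 1) - 2 * p k + p (k - 1)

/-- Convexity of a sequence on `ℕ`. -/
def IsConvexSeq (p : ℕ → ℝ) : Prop :=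
  ∀ k, 1 ≤ k → 0 ≤ laplacian p k

/-- The class of convex sequences with finite `ℓ²` norm. -/
def convexClass : Set (ℕ → ℝ) :=
  {p | Memℓp p 2 ∧ IsConvexSeq p}

/-- `p` is a probability mass function on `ℕ`. -/
def IsPmf (p : ℕ → ℝ) : Prop :=
  (∀ k, 0 ≤ p k) ∧ HasSum p 1

/-! ### Existence and uniqueness of least-squares projections -/

theorem existsUnique_leastSquares {ι : Type*} (q : ι → ℝ) (hq : Memℓp q 2) (D : Set (ι → ℝ))
    (h0 : 0 ∈ D) (hc : Convex ℝ D) (hcl : IsClosed D) :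
    ∃! p : ι → ℝ, (Memℓp p 2 ∧ p ∈ D) ∧ ∀ r : ι → ℝ, Memℓp r 2 ∧ r ∈ D →
      ∑' j, (q j - p j) ^ 2 ≤ ∑' j, (q j - r j) ^ 2 := by
  let E := lp (fun _ : ι => ℝ) 2
  let K : Set E := {f | (f : ι → ℝ) ∈ D}
  have hKne : K.Nonempty := ⟨0, h0⟩
  have hcont : Continuous (fun f : E => (f : ι → ℝ)) :=
    (lp.uniformContinuous_coe (E := fun _ : ι => ℝ) (p := 2)).continuous
  have hKcl : IsClosed K := hcl.preimage hcont
  have hKc : Convex ℝ K := by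
    intro f hf g hg a b ha hb hab
    exact hc hf hg ha hb hab
  have hnorm : ∀ f : E, ‖f‖ ^ 2 = ∑' j, (f j) ^ 2 := by
    intro f
    have := lp.norm_rpow_eq_tsum (p := 2) (E := fun _ : ι => ℝ) (by norm_num) f
    simpa using this
  let Q : E := ⟨q, hq⟩
  have hdist : ∀ f : E, ‖Q - f‖ ^ 2 = ∑' j, (q j - f j) ^ 2 := by
    intro f
    rw [hnorm]
    rfl
  obtain ⟨v, hvK, hv⟩ := exists_norm_eq_iInf_of_complete_convex hKne hKcl.isComplete hKc Q
  have hin := (norm_eq_iInf_iff_real_inner_le_zero hKc hvK).1 hv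
  have hexp : ∀ w : E, ‖Q - w‖ ^ 2
      = ‖Q - v‖ ^ 2 - 2 * inner ℝ (Q - v) (w - v) + ‖w - v‖ ^ 2 := by
    intro w
    rw [← norm_sub_sq_real]
    congr 2
    abel
  refine ⟨(v : ι → ℝ), ⟨⟨lp.memℓp v, hvK⟩, ?_⟩, ?_⟩
  · rintro r ⟨hr, hrD⟩
    have h1 := hin ⟨r, hr⟩ hrD
    have h2 := hexp ⟨r, hr⟩
    have h3 := hdist ⟨r, hr⟩
    have h4 := hdist v
    have h5 : ∑' j, (q j - r j) ^ 2 = ‖Q - (⟨r, hr⟩ : E)‖ ^ 2 := h3.symm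
    rw [h5, ← h4, h2]
    nlinarith [sq_nonneg ‖(⟨r, hr⟩ : E) - v‖]
  · rintro r ⟨⟨hr, hrD⟩, hmin⟩
    have h1 := hin ⟨r, hr⟩ hrD
    have h2 := hexp ⟨r, hr⟩
    have h3 : ‖Q - (⟨r, hr⟩ : E)‖ ^ 2 = ∑' j, (q j - r j) ^ 2 := hdist ⟨r, hr⟩
    have h4 := hdist v
    have h5 := hmin v ⟨lp.memℓp v, hvK⟩
    rw [← h3, ← h4] at h5
    have h6 : ‖(⟨r, hr⟩ : E) - v‖ ^ 2 = 0 := by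
      nlinarith [sq_nonneg ‖(⟨r, hr⟩ : E) - v‖]
    have h7 : (⟨r, hr⟩ : E) = v := by
      rw [sq_eq_zero_iff, norm_eq_zero, sub_eq_zero] at h6
      exact h6
    exact congrArg (fun f : E => (f : ι → ℝ)) h7

/-! ### The empirical pmf and the convex least-squares estimator -/

/-- The empirical pmf `p_n(j) = n⁻¹ #{i : x_i = j}` of a sample `x` of size `n`. -/
def empiricalPmf {n : ℕ} (x : Fin n → ℕ) (j : ℕ) : ℝ :=
  (1 / (n : ℝ)) * ∑ i, if x i = j then 1 else 0

/-- The least-squares criterion `½ ∑_j (q(j) - p(j))²`. -/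
def lsCriterion (q p : ℕ → ℝ) : ℝ :=
  (1 / 2) * ∑' j, (q j - p j) ^ 2

/-- `p` minimizes the least-squares criterion over the class of convex square-summable
sequences. -/
def IsConvexLSE (q p : ℕ → ℝ) : Prop :=
  p ∈ convexClass ∧ ∀ r ∈ convexClass, lsCriterion q p ≤ lsCriterion q r

theorem memℓp_empiricalPmf {n : ℕ} (x : Fin n → ℕ) : Memℓp (empiricalPmf x) 2 := by
  refine (memℓp_zero ?_).of_exponent_ge (by simp)
  refine (Set.finite_range x).subset ?_
  intro j hj
  by_contra hne
  apply hj
  have : ∀ i, x i ≠ j := fun i hi => hne ⟨i, hi⟩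
  simp [empiricalPmf, this]

theorem existsUnique_isConvexLSE (q : ℕ → ℝ) (hq : Memℓp q 2) : ∃! p, IsConvexLSE q p := by
  have hc : Convex ℝ {p : ℕ → ℝ | IsConvexSeq p} := by
    intro f hf g hg a b ha hb _ k hk
    have e : laplacian (a • f + b • g) k = a * laplacian f k + b * laplacian g k := by
      simp only [laplacian, Pi.add_apply, Pi.smul_apply, smul_eq_mul]
      ring
    rw [e]
    exact add_nonneg (mul_nonneg ha (hf k hk)) (mul_nonneg hb (hg k hk))
  have hcl : IsClosed {p : ℕ → ℝ | IsConvexSeq p} := by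
    simp only [IsConvexSeq, Set.ofPred_forall, laplacian]
    refine isClosed_iInter fun k => isClosed_iInter fun _ => ?_
    exact isClosed_le continuous_const (by fun_prop)
  have h0 : (0 : ℕ → ℝ) ∈ {p : ℕ → ℝ | IsConvexSeq p} := by
    intro k _
    simp [laplacian]
  have key := existsUnique_leastSquares q hq _ h0 hc hcl
  simpa only [IsConvexLSE, convexClass, lsCriterion, Set.mem_ofPred_eq,
    mul_le_mul_iff_right₀ (show (0 : ℝ) < 1 / 2 by norm_num)] using key

/-- The convex least-squares estimator based on the sample `x`: the unique minimizer of
`½ ∑_j (p_n(j) - p(j))²` over the convex square-summable sequences `p`, where `p_n` is the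
empirical pmf of `x`. -/
def convexLSE {n : ℕ} (x : Fin n → ℕ) : ℕ → ℝ :=
  (existsUnique_isConvexLSE (empiricalPmf x) (memℓp_empiricalPmf x)).choose

theorem convexLSE_spec {n : ℕ} (x : Fin n → ℕ) : IsConvexLSE (empiricalPmf x) (convexLSE x) :=
  (existsUnique_isConvexLSE (empiricalPmf x) (memℓp_empiricalPmf x)).choose_spec.1

/-! ### The limit -/

/-- A standard Brownian bridge on `[0, 1]`: a centered Gaussian process with covariance
`min(s, t) - s t` and almost surely continuous paths. (Only the times in `[0, 1]` matter.) -/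
structure IsBrownianBridge {Ω : Type*} [MeasurableSpace Ω] (U : ℝ → Ω → ℝ) (P : Measure Ω) :
    Prop where
  isGaussianProcess : IsGaussianProcess (fun t : Set.Icc (0 : ℝ) 1 => U t) P
  integral_eq_zero : ∀ t ∈ Set.Icc (0 : ℝ) 1, ∫ ω, U t ω ∂P = 0
  covariance_eq : ∀ s ∈ Set.Icc (0 : ℝ) 1, ∀ t ∈ Set.Icc (0 : ℝ) 1,
    covariance (U s) (U t) P = min s t - s * t
  continuous_paths : ∀ᵐ ω ∂P, ContinuousOn (fun t => U t ω) (Set.Icc 0 1)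

/-- The vector `W(k) = U(F_p(k)) - U(F_p(k-1))`, `k = 0, …, S + 1`, for a path `u` of `U`. -/
def bridgeIncrement (p : ℕ → ℝ) (S : ℕ) (u : ℝ → ℝ) (k : Fin (S + 2)) : ℝ :=
  u (cumSum p k) - u (cumSumPred p k)

/-- The interior knots of `p`: the points `0 < k < S + 1` with `Δp(k) > 0`. -/
def interiorKnots (p : ℕ → ℝ) (S : ℕ) : Set ℕ :=
  {k | 0 < k ∧ k < S + 1 ∧ 0 < laplacian p k}

/-- The cone of vectors `(g(0), …, g(S+1))` that are convex between any two consecutive elements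
of `K ∪ {0, S + 1}`, i.e. convex at every point of `{1, …, S}` that does not lie in `K`. -/
def piecewiseConvex (S : ℕ) (K : Set ℕ) : Set (Fin (S + 2) → ℝ) :=
  {g | ∀ (k : ℕ) (_ : 1 ≤ k) (_ : k < S + 1), k ∉ K →
    0 ≤ g ⟨k + 1, by omega⟩ - 2 * g ⟨k, by omega⟩ + g ⟨k - 1, by omega⟩}

/-- `g` minimizes `Φ(g) = ½ ∑_{k=0}^{S+1} (g(k) - w(k))²` over the cone of vectors that are convex
between consecutive elements of `K ∪ {0, S + 1}`. -/
def IsPiecewiseConvexProj (S : ℕ) (K : Set ℕ) (w g : Fin (S + 2) → ℝ) : Prop :=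
  g ∈ piecewiseConvex S K ∧ ∀ h ∈ piecewiseConvex S K,
    (1 / 2) * ∑ k, (g k - w k) ^ 2 ≤ (1 / 2) * ∑ k, (h k - w k) ^ 2

theorem existsUnique_isPiecewiseConvexProj (S : ℕ) (K : Set ℕ) (w : Fin (S + 2) → ℝ) :
    ∃! g, IsPiecewiseConvexProj S K w g := by
  have hc : Convex ℝ (piecewiseConvex S K) := by
    intro f hf g hg a b ha hb _ k hk1 hk2 hkK
    have h1 := mul_nonneg ha (hf k hk1 hk2 hkK)
    have h2 := mul_nonneg hb (hg k hk1 hk2 hkK)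
    simp only [Pi.add_apply, Pi.smul_apply, smul_eq_mul]
    linarith
  have hcl : IsClosed (piecewiseConvex S K) := by
    simp only [piecewiseConvex, Set.ofPred_forall]
    refine isClosed_iInter fun k => isClosed_iInter fun _ => isClosed_iInter fun _ =>
      isClosed_iInter fun _ => ?_
    exact isClosed_le continuous_const (by fun_prop)
  have h0 : (0 : Fin (S + 2) → ℝ) ∈ piecewiseConvex S K := by
    intro k _ _ _
    simp
  have hmem : ∀ g : Fin (S + 2) → ℝ, Memℓp g 2 := fun g => Memℓp.all g
  have key := existsUnique_leastSquares w (hmem w) _ h0 hc hcl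
  simp only [hmem, true_and, tsum_fintype] at key
  simpa only [IsPiecewiseConvexProj, sub_sq_comm _ (w _),
    mul_le_mul_iff_right₀ (show (0 : ℝ) < 1 / 2 by norm_num)] using key

/-- The unique minimizer of `½ ∑_k (g(k) - w(k))²` over the cone of vectors `g` that are convex
between consecutive elements of `K ∪ {0, S + 1}`. -/
def piecewiseConvexProj (S : ℕ) (K : Set ℕ) (w : Fin (S + 2) → ℝ) : Fin (S + 2) → ℝ :=
  (existsUnique_isPiecewiseConvexProj S K w).choose

theorem piecewiseConvexProj_spec (S : ℕ) (K : Set ℕ) (w : Fin (S + 2) → ℝ) :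
    IsPiecewiseConvexProj S K w (piecewiseConvexProj S K w) :=
  (existsUnique_isPiecewiseConvexProj S K w).choose_spec.1

end

end ConvexPmf

/-!
The limit theorem rests on an exact localization of the estimator. Let `w = q - p₀` be the error of
the empirical pmf `q` on `{0, …, S + 1}`, and `g` its projection onto the cone of vectors that are
convex off the interior knots of `p₀`. If `w` is small, then `p₀ + g`, extended by zero, *is* the
convex least-squares estimator (`isConvexLSE_add_extendZero`):

* Restricting a convex sequence `r` to `{0, …, S + 1}` and subtracting `p₀` gives a vector of the
  cone, because `Δp₀` vanishes off the knots; and beyond `S + 1` nothing beats the value zero.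
  So `p₀ + g` is at least as close to `q` as any competitor.
* It is itself convex: off the knots since `g` lies in the cone, at the knots and at `S + 1` since
  `Δp₀` is bounded away from zero there while `|g| ≤ |w|` is small, and at `S + 2` since raising the
  last coordinate never leaves the cone, whence `g (S + 1) ≥ w (S + 1) = 0`.

The projection commutes with multiplication by `√n`. By the strong law the empirical pmf is
eventually close enough to `p₀`, so almost surely, for all large `n`, the normalized error of the
estimator is the projection of the normalized error of the empirical pmf
(`ae_eventually_convexLSE_eq`). The latter converges in distribution to the increments of the
Brownian bridge, by the one-dimensional central limit theorem and the Cramér–Wold device, both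
vectors having the multinomial covariance (`tendstoInDistribution_empiricalPmf`). The projection
is `1`-Lipschitz and cumulative sums are continuous, so the continuous mapping theorem concludes.
-/

namespace ConvexPmf

/-! ### The projection onto the cone of piecewise convex vectors -/

section Projection

variable {S : ℕ} {K : Set ℕ}

theorem piecewiseConvex_add {g h : Fin (S + 2) → ℝ} (hg : g ∈ piecewiseConvex S K)
    (hh : h ∈ piecewiseConvex S K) : g + h ∈ piecewiseConvex S K := by
  intro k hk1 hk2 hkK
  have h1 := hg k hk1 hk2 hkK
  have h2 := hh k hk1 hk2 hkK
  simp only [Pi.add_apply]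
  linarith

theorem piecewiseConvex_smul {g : Fin (S + 2) → ℝ} (hg : g ∈ piecewiseConvex S K) {c : ℝ}
    (hc : 0 ≤ c) : c • g ∈ piecewiseConvex S K := by
  intro k hk1 hk2 hkK
  have h1 := mul_nonneg hc (hg k hk1 hk2 hkK)
  simp only [Pi.smul_apply, smul_eq_mul]
  linarith

theorem isPiecewiseConvexProj_unique {w g g' : Fin (S + 2) → ℝ}
    (h : IsPiecewiseConvexProj S K w g) (h' : IsPiecewiseConvexProj S K w g') : g = g' :=
  (existsUnique_isPiecewiseConvexProj S K w).unique h h'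

/-- First-order condition for the projection `g` of `w`: the inner product of `g - w` with any
feasible direction is nonnegative, as otherwise a small step in it would decrease the distance. -/
theorem IsPiecewiseConvexProj.inner_nonneg {w g : Fin (S + 2) → ℝ}
    (h : IsPiecewiseConvexProj S K w g) {d : Fin (S + 2) → ℝ}
    (hd : ∀ᶠ t in 𝓝[>] (0 : ℝ), g + t • d ∈ piecewiseConvex S K) :
    0 ≤ ∑ k, (g k - w k) * d k := by
  have key : ∀ᶠ t in 𝓝[>] (0 : ℝ),
      0 ≤ ∑ k, (g k - w k) * d k + t * ((1 / 2) * ∑ k, d k ^ 2) := by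
    filter_upwards [hd, self_mem_nhdsWithin] with t ht ht0
    have h1 := h.2 _ ht
    have h2 : ∑ k, ((g + t • d) k - w k) ^ 2 = ∑ k, (g k - w k) ^ 2
        + 2 * t * ∑ k, (g k - w k) * d k + t ^ 2 * ∑ k, d k ^ 2 := by
      simp only [Finset.mul_sum, ← Finset.sum_add_distrib]
      refine Finset.sum_congr rfl fun k _ => ?_
      simp only [Pi.add_apply, Pi.smul_apply, smul_eq_mul]
      ring
    rw [h2] at h1
    have ht0' : (0 : ℝ) < t := ht0
    refine nonneg_of_mul_nonneg_right ?_ ht0'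
    linarith
  have lim : Tendsto (fun t : ℝ => ∑ k, (g k - w k) * d k + t * ((1 / 2) * ∑ k, d k ^ 2))
      (𝓝[>] (0 : ℝ)) (𝓝 (∑ k, (g k - w k) * d k)) := by
    have : Continuous (fun t : ℝ =>
        ∑ k, (g k - w k) * d k + t * ((1 / 2) * ∑ k, d k ^ 2)) := by fun_prop
    have h0 := (this.tendsto 0).mono_left (nhdsWithin_le_nhds (s := Set.Ioi 0))
    simpa using h0
  exact ge_of_tendsto lim key

theorem IsPiecewiseConvexProj.inner_sub_nonneg {w g h : Fin (S + 2) → ℝ}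
    (hg : IsPiecewiseConvexProj S K w g) (hh : h ∈ piecewiseConvex S K) :
    0 ≤ ∑ k, (g k - w k) * (h k - g k) := by
  refine hg.inner_nonneg (d := h - g) ?_
  filter_upwards [self_mem_nhdsWithin, mem_nhdsWithin_of_mem_nhds (Iio_mem_nhds one_pos)]
    with t (ht : 0 < t) (ht' : t < 1)
  have e : g + t • (h - g) = (1 - t) • g + t • h := by module
  rw [e]
  exact piecewiseConvex_add (piecewiseConvex_smul hg.1 (by linarith))
    (piecewiseConvex_smul hh ht.le)

/-- The last coordinate is bounded below by that of the projected vector, because raising it keeps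
all second differences nonnegative. -/
theorem IsPiecewiseConvexProj.le_last {w g : Fin (S + 2) → ℝ}
    (hg : IsPiecewiseConvexProj S K w g) : w (Fin.last (S + 1)) ≤ g (Fin.last (S + 1)) := by
  have h := hg.inner_nonneg (d := Pi.single (Fin.last (S + 1)) 1) ?_
  · simpa [Pi.single_apply] using h
  · filter_upwards [self_mem_nhdsWithin] with t (ht : 0 < t)
    intro k hk1 hk2 hkK
    have h0 := hg.1 k hk1 hk2 hkK
    have e1 : (⟨k, by omega⟩ : Fin (S + 2)) ≠ Fin.last (S + 1) := by
      simp [Fin.ext_iff]; omega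
    have e2 : (⟨k - 1, by omega⟩ : Fin (S + 2)) ≠ Fin.last (S + 1) := by
      simp [Fin.ext_iff]; omega
    have e3 : 0 ≤ (Pi.single (Fin.last (S + 1)) 1 : Fin (S + 2) → ℝ) ⟨k + 1, by omega⟩ := by
      rw [Pi.single_apply]; split_ifs <;> norm_num
    simp only [Pi.add_apply, Pi.smul_apply, smul_eq_mul, Pi.single_eq_of_ne e1,
      Pi.single_eq_of_ne e2]
    have := mul_nonneg ht.le e3
    linarith

theorem IsPiecewiseConvexProj.sum_sq_le {w g : Fin (S + 2) → ℝ}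
    (hg : IsPiecewiseConvexProj S K w g) : ∑ k, g k ^ 2 ≤ ∑ k, w k ^ 2 := by
  have h0 : (0 : Fin (S + 2) → ℝ) ∈ piecewiseConvex S K := by
    intro k _ _ _
    simp
  have h1 := hg.inner_sub_nonneg h0
  have h2 : 2 * ∑ k, (g k - w k) * ((0 : Fin (S + 2) → ℝ) k - g k)
      ≤ ∑ k, w k ^ 2 - ∑ k, g k ^ 2 := by
    rw [Finset.mul_sum, ← Finset.sum_sub_distrib]
    refine Finset.sum_le_sum fun k _ => ?_
    simp only [Pi.zero_apply]
    nlinarith [sq_nonneg (g k - w k)]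
  linarith

/-- The projection onto the cone is `1`-Lipschitz for the Euclidean distance. -/
theorem IsPiecewiseConvexProj.sum_sub_sq_le {w w' g g' : Fin (S + 2) → ℝ}
    (hg : IsPiecewiseConvexProj S K w g) (hg' : IsPiecewiseConvexProj S K w' g') :
    ∑ k, (g k - g' k) ^ 2 ≤ ∑ k, (w k - w' k) ^ 2 := by
  have h1 := hg.inner_sub_nonneg hg'.1
  have h2 := hg'.inner_sub_nonneg hg.1
  have h3 : 2 * (∑ k, (g k - w k) * (g' k - g k) + ∑ k, (g' k - w' k) * (g k - g' k))
      ≤ ∑ k, (w k - w' k) ^ 2 - ∑ k, (g k - g' k) ^ 2 := by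
    rw [← Finset.sum_add_distrib, Finset.mul_sum, ← Finset.sum_sub_distrib]
    refine Finset.sum_le_sum fun k _ => ?_
    nlinarith [sq_nonneg (g k - g' k - (w k - w' k))]
  linarith

theorem IsPiecewiseConvexProj.smul {w g : Fin (S + 2) → ℝ}
    (hg : IsPiecewiseConvexProj S K w g) {c : ℝ} (hc : 0 ≤ c) :
    IsPiecewiseConvexProj S K (c • w) (c • g) := by
  refine ⟨piecewiseConvex_smul hg.1 hc, fun h hh => ?_⟩
  rcases hc.eq_or_lt with rfl | hc
  · simp only [zero_smul, Pi.zero_apply, sub_zero, ne_eq, OfNat.ofNat_ne_zero, not_false_eq_true,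
      zero_pow, Finset.sum_const_zero, mul_zero]
    positivity
  · have h1 := hg.2 _ (piecewiseConvex_smul hh (inv_nonneg.2 hc.le))
    have h2 : ∑ k, ((c • g) k - (c • w) k) ^ 2 = c ^ 2 * ∑ k, (g k - w k) ^ 2 := by
      rw [Finset.mul_sum]
      refine Finset.sum_congr rfl fun k _ => ?_
      simp only [Pi.smul_apply, smul_eq_mul]
      ring
    have h3 : ∑ k, (h k - (c • w) k) ^ 2 = c ^ 2 * ∑ k, ((c⁻¹ • h) k - w k) ^ 2 := by
      rw [Finset.mul_sum]
      refine Finset.sum_congr rfl fun k _ => ?_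
      simp only [Pi.smul_apply, smul_eq_mul]
      field_simp
    rw [h2, h3]
    nlinarith [mul_le_mul_of_nonneg_left h1 (sq_nonneg c)]

theorem piecewiseConvexProj_smul {c : ℝ} (hc : 0 ≤ c) (w : Fin (S + 2) → ℝ) :
    piecewiseConvexProj S K (c • w) = c • piecewiseConvexProj S K w :=
  isPiecewiseConvexProj_unique (piecewiseConvexProj_spec S K _)
    ((piecewiseConvexProj_spec S K w).smul hc)

theorem continuous_piecewiseConvexProj : Continuous (piecewiseConvexProj S K) := by
  refine continuous_pi fun k => continuous_iff_continuousAt.2 fun w => ?_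
  rw [ContinuousAt, tendsto_iff_dist_tendsto_zero]
  have hc : Continuous fun w' : Fin (S + 2) → ℝ => √(∑ j, (w' j - w j) ^ 2) := by fun_prop
  refine squeeze_zero (fun _ => dist_nonneg) (fun w' => ?_)
    (by simpa using hc.tendsto w)
  rw [Real.dist_eq]
  refine Real.abs_le_sqrt (le_trans ?_
    ((piecewiseConvexProj_spec S K w').sum_sub_sq_le (piecewiseConvexProj_spec S K w)))
  exact Finset.single_le_sum (f := fun j =>
    (piecewiseConvexProj S K w' j - piecewiseConvexProj S K w j) ^ 2)
    (fun _ _ => sq_nonneg _) (Finset.mem_univ k)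

end Projection

/-! ### Exact localization of the convex least-squares estimator -/

/-- Extension of a vector on `{0, …, N - 1}` to a sequence on `ℕ` by zero. -/
def extendZero {N : ℕ} (g : Fin N → ℝ) (k : ℕ) : ℝ :=
  if h : k < N then g ⟨k, h⟩ else 0

theorem extendZero_of_lt {N : ℕ} (g : Fin N → ℝ) {k : ℕ} (h : k < N) :
    extendZero g k = g ⟨k, h⟩ := dif_pos h

theorem extendZero_of_le {N : ℕ} (g : Fin N → ℝ) {k : ℕ} (h : N ≤ k) :
    extendZero g k = 0 := dif_neg (by omega)

theorem abs_extendZero_le {N : ℕ} {g : Fin N → ℝ} {δ : ℝ} (hδ : 0 ≤ δ) (h : ∀ k, |g k| ≤ δ)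
    (k : ℕ) : |extendZero g k| ≤ δ := by
  unfold extendZero
  split_ifs
  · exact h _
  · simpa using hδ

theorem memℓp_of_forall_le_eq_zero {p : ℕ → ℝ} {N : ℕ} (h : ∀ k, N ≤ k → p k = 0) :
    Memℓp p 2 := by
  refine (memℓp_zero ?_).of_exponent_ge (by simp)
  refine (Set.finite_lt_nat N).subset fun j hj => ?_
  by_contra hne
  exact hj (h j (not_lt.1 hne))

theorem laplacian_add (p q : ℕ → ℝ) (k : ℕ) :
    laplacian (fun j => p j + q j) k = laplacian p k + laplacian q k := by
  simp only [laplacian]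
  ring

theorem neg_le_laplacian {p : ℕ → ℝ} {δ : ℝ} (h : ∀ k, |p k| ≤ δ) (k : ℕ) :
    -(4 * δ) ≤ laplacian p k := by
  have h1 := abs_le.1 (h (k + 1))
  have h2 := abs_le.1 (h k)
  have h3 := abs_le.1 (h (k - 1))
  simp only [laplacian]
  linarith

/-- At the finitely many points of `{1, …, S + 1}` where the second difference is positive, it is
bounded away from zero. The factor `4` fits `neg_le_laplacian`: perturbations of size `δ` change a
second difference by at most `4 * δ`. -/
theorem exists_laplacian_gap (p : ℕ → ℝ) (S : ℕ) :
    ∃ δ > 0, ∀ k, 1 ≤ k → k ≤ S + 1 → 0 < laplacian p k → 4 * δ ≤ laplacian p k := by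
  classical
  let T := (Finset.Icc 1 (S + 1)).filter fun k => 0 < laplacian p k
  rcases T.eq_empty_or_nonempty with hT | hT
  · refine ⟨1, one_pos, fun k h1 h2 h3 => ?_⟩
    have : k ∈ T := by simp [T, h1, h2, h3]
    simp [hT] at this
  · obtain ⟨m, hm, hmin⟩ := T.exists_min_image (laplacian p) hT
    have hm' : 0 < laplacian p m := (Finset.mem_filter.1 hm).2
    refine ⟨laplacian p m / 4, by positivity, fun k h1 h2 h3 => ?_⟩
    have := hmin k (by simp [T, h1, h2, h3])
    linarith

theorem tsum_sq_sub_eq_sum_add_tsum {q r : ℕ → ℝ} (hq : Memℓp q 2) (hr : Memℓp r 2) (N : ℕ) :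
    ∑' j, (q j - r j) ^ 2
      = ∑ k : Fin N, (q k - r k) ^ 2 + ∑' j, (q (j + N) - r (j + N)) ^ 2 := by
  have hs : Summable fun j => (q j - r j) ^ 2 := by
    have := (hq.sub hr).summable (by norm_num)
    simpa using this
  rw [← hs.sum_add_tsum_nat_add N, Finset.sum_range]

/-- If `q` vanishes beyond `S` and is close enough to the convex pmf `p₀`, then the
least-squares projection of `q` onto the convex sequences is `p₀ + g`, where `g` is the projection
of `q - p₀` onto the cone of piecewise convex vectors, extended by zero. Convexity at the knots and
at `S + 1` holds because the second difference of `p₀` is positive there; convexity at `S + 2` holds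
because `g (S + 1) ≥ q (S + 1) - p₀ (S + 1) = 0`. -/
theorem isConvexLSE_add_extendZero {S : ℕ} {p₀ q : ℕ → ℝ} (hconv : IsConvexSeq p₀)
    (hp : ∀ k, S < k → p₀ k = 0) (hpS : 0 < p₀ S) (hq : ∀ k, S < k → q k = 0)
    {δ : ℝ} (hδ0 : 0 ≤ δ)
    (hδ : ∀ k, 1 ≤ k → k ≤ S + 1 → 0 < laplacian p₀ k → 4 * δ ≤ laplacian p₀ k)
    {g : Fin (S + 2) → ℝ}
    (hg : IsPiecewiseConvexProj S (interiorKnots p₀ S) (fun k => q k - p₀ k) g)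
    (hgδ : ∀ k, |g k| ≤ δ) :
    IsConvexLSE q (fun k => p₀ k + extendZero g k) := by
  have hlast : 0 ≤ g (Fin.last (S + 1)) := by
    have h := hg.le_last
    simpa [hp (S + 1) (by omega), hq (S + 1) (by omega)] using h
  have hzero : ∀ k, S + 2 ≤ k → p₀ k + extendZero g k = 0 := fun k hk => by
    rw [hp k (by omega), extendZero_of_le g hk, add_zero]
  have hmem : Memℓp (fun k => p₀ k + extendZero g k) 2 := memℓp_of_forall_le_eq_zero hzero
  have hmemq : Memℓp q 2 := memℓp_of_forall_le_eq_zero (N := S + 1) fun k hk => hq k (by omega)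
  refine ⟨⟨hmem, fun k hk => ?_⟩, fun r hr => ?_⟩
  · rw [laplacian_add]
    rcases le_or_gt k (S + 1) with hk1 | hk1
    · have hb := neg_le_laplacian (abs_extendZero_le hδ0 hgδ) k
      rcases (hconv k hk).eq_or_lt with h0 | h0
      · -- a point with vanishing second difference lies below `S + 1` and is no knot
        have hkS : k < S + 1 := by
          rcases hk1.lt_or_eq with h | rfl
          · exact h
          · exfalso
            simp [laplacian, hp (S + 1) (by omega), hp (S + 2) (by omega)] at h0
            linarith
        have := hg.1 k hk hkS (fun hK => by have := hK.2.2; linarith)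
        rw [← h0, zero_add, laplacian, extendZero_of_lt g (show k + 1 < S + 2 by omega),
          extendZero_of_lt g (show k < S + 2 by omega),
          extendZero_of_lt g (show k - 1 < S + 2 by omega)]
        exact this
      · have := hδ k hk hk1 h0
        linarith
    · refine add_nonneg (hconv k hk) ?_
      rw [laplacian, extendZero_of_le g (show S + 2 ≤ k + 1 by omega),
        extendZero_of_le g (show S + 2 ≤ k by omega)]
      rcases (show S + 2 ≤ k from hk1).eq_or_lt with rfl | h
      · rw [extendZero_of_lt g (show S + 2 - 1 < S + 2 by omega)]
        have : (⟨S + 2 - 1, by omega⟩ : Fin (S + 2)) = Fin.last (S + 1) := by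
          simp [Fin.ext_iff]
        rw [this]
        linarith
      · rw [extendZero_of_le g (show S + 2 ≤ k - 1 by omega)]
        norm_num
  · have hrest : (fun k : Fin (S + 2) => r k - p₀ k) ∈ piecewiseConvex S (interiorKnots p₀ S) := by
      intro k hk1 hk2 hkK
      have h1 := hr.2 k hk1
      have h2 : laplacian p₀ k ≤ 0 := not_lt.1 fun h => hkK ⟨hk1, hk2, h⟩
      simp only [laplacian] at h1 h2
      linarith
    have h1 := hg.2 _ hrest
    rw [lsCriterion, lsCriterion, tsum_sq_sub_eq_sum_add_tsum hmemq hmem (S + 2),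
      tsum_sq_sub_eq_sum_add_tsum hmemq hr.1 (S + 2)]
    have e1 : ∑' j, (q (j + (S + 2)) - (p₀ (j + (S + 2)) + extendZero g (j + (S + 2)))) ^ 2 = 0 := by
      have : ∀ j, (q (j + (S + 2)) - (p₀ (j + (S + 2)) + extendZero g (j + (S + 2)))) ^ 2 = 0 := by
        intro j
        rw [hzero _ (by omega), hq _ (by omega)]
        norm_num
      simp [this]
    have e2 : 0 ≤ ∑' j, (q (j + (S + 2)) - r (j + (S + 2))) ^ 2 :=
      tsum_nonneg fun _ => sq_nonneg _
    have e3 : ∑ k : Fin (S + 2), (q k - (p₀ k + extendZero g k)) ^ 2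
        = ∑ k, (g k - (q k - p₀ k)) ^ 2 := by
      refine Finset.sum_congr rfl fun k _ => ?_
      rw [extendZero_of_lt g k.2]
      ring
    have e4 : ∑ k : Fin (S + 2), (q k - r k) ^ 2
        = ∑ k : Fin (S + 2), ((r k - p₀ k) - (q k - p₀ k)) ^ 2 :=
      Finset.sum_congr rfl fun k _ => by ring
    rw [e1, e3, e4]
    linarith

theorem convexLSE_eq_of_isConvexLSE {n : ℕ} {x : Fin n → ℕ} {p : ℕ → ℝ}
    (h : IsConvexLSE (empiricalPmf x) p) : convexLSE x = p :=
  (existsUnique_isConvexLSE _ (memℓp_empiricalPmf x)).unique (convexLSE_spec x) h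

/-- For a sample in `{0, …, S}` whose empirical pmf is close to `p₀`, the error of the convex
least-squares estimator on `{0, …, S + 1}` is exactly the projection of the error of the empirical
pmf onto the cone of piecewise convex vectors. -/
theorem convexLSE_sub_eq_piecewiseConvexProj {S : ℕ} {p₀ : ℕ → ℝ} (hconv : IsConvexSeq p₀)
    (hp : ∀ k, S < k → p₀ k = 0) (hpS : 0 < p₀ S) {δ : ℝ} (hδ0 : 0 ≤ δ)
    (hδ : ∀ k, 1 ≤ k → k ≤ S + 1 → 0 < laplacian p₀ k → 4 * δ ≤ laplacian p₀ k)
    {n : ℕ} {x : Fin n → ℕ} (hx : ∀ i, x i ≤ S)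
    (hclose : ∑ k : Fin (S + 2), (empiricalPmf x k - p₀ k) ^ 2 ≤ δ ^ 2) (k : Fin (S + 2)) :
    convexLSE x k - p₀ k = piecewiseConvexProj S (interiorKnots p₀ S)
      (fun k => empiricalPmf x k - p₀ k) k := by
  have hg := piecewiseConvexProj_spec S (interiorKnots p₀ S)
    (fun k : Fin (S + 2) => empiricalPmf x k - p₀ k)
  set g := piecewiseConvexProj S (interiorKnots p₀ S)
    (fun k : Fin (S + 2) => empiricalPmf x k - p₀ k)
  have hq : ∀ k, S < k → empiricalPmf x k = 0 := by
    intro k hk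
    have : ∀ i, x i ≠ k := fun i => by have := hx i; omega
    simp [empiricalPmf, this]
  have hgδ : ∀ k, |g k| ≤ δ := by
    intro k
    refine abs_le_of_sq_le_sq ?_ hδ0
    exact (Finset.single_le_sum (f := fun j => g j ^ 2) (fun _ _ => sq_nonneg _)
      (Finset.mem_univ k)).trans (hg.sum_sq_le.trans hclose)
  rw [convexLSE_eq_of_isConvexLSE
    (isConvexLSE_add_extendZero hconv hp hpS hq hδ0 hδ hg hgδ)]
  simp [extendZero_of_lt g k.2]

/-! ### The Cramér–Wold device -/

/-- The characteristic function of a random vector at `t` is that of its linear combination with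
coefficients `t`, taken at `1`. -/
theorem charFun_map_toLp {ι Ω : Type*} [Fintype ι] [MeasurableSpace Ω] {P : Measure Ω}
    {X : Ω → ι → ℝ} (hX : AEMeasurable X P) (t : EuclideanSpace ℝ ι) :
    charFun (P.map fun ω => WithLp.toLp 2 (X ω)) t
      = charFun (P.map fun ω => ∑ i, t i * X ω i) 1 := by
  rw [charFun_apply, charFun_apply, integral_map (by fun_prop) (by fun_prop),
    integral_map (by fun_prop) (by fun_prop)]
  refine integral_congr_ae (Eventually.of_forall fun ω => ?_)
  simp [PiLp.inner_apply]

/-- **Cramér–Wold device**: random vectors converge in distribution as soon as all their linear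
combinations do. -/
theorem tendstoInDistribution_of_forall_linear {ι Ω Ω' : Type*} [Fintype ι] [MeasurableSpace Ω]
    [MeasurableSpace Ω'] {P : Measure Ω} [IsProbabilityMeasure P] {P' : Measure Ω'}
    [IsProbabilityMeasure P'] {X : ℕ → Ω → ι → ℝ} {Z : Ω' → ι → ℝ}
    (hX : ∀ n, AEMeasurable (X n) P) (hZ : AEMeasurable Z P')
    (h : ∀ t : ι → ℝ, TendstoInDistribution (fun n ω => ∑ i, t i * X n ω i) atTop
      (fun ω => ∑ i, t i * Z ω i) (fun _ => P) P') :
    TendstoInDistribution X atTop Z (fun _ => P) P' := by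
  have hX' : ∀ n, AEMeasurable (fun ω => WithLp.toLp 2 (X n ω)) P := fun n => by fun_prop
  have hZ' : AEMeasurable (fun ω => WithLp.toLp 2 (Z ω)) P' := by fun_prop
  have key : TendstoInDistribution (fun n ω => WithLp.toLp 2 (X n ω)) atTop
      (fun ω => WithLp.toLp 2 (Z ω)) (fun _ => P) P' := by
    refine ⟨hX', hZ', ?_⟩
    refine ProbabilityMeasure.tendsto_iff_tendsto_charFun.2 fun t => ?_
    have h1 := ProbabilityMeasure.tendsto_iff_tendsto_charFun.1 (h t).tendsto 1
    simp only [ProbabilityMeasure.coe_mk] at h1 ⊢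
    rw [charFun_map_toLp hZ]
    refine h1.congr fun n => ?_
    rw [charFun_map_toLp (hX n)]
  exact key.continuous_comp (g := fun v : EuclideanSpace ℝ ι => (WithLp.ofLp v)) (by fun_prop)

/-! ### Increments of the Brownian bridge -/

section Bridge

variable {p : ℕ → ℝ} {S : ℕ}

theorem cumSum_eq_cumSumPred_add (p : ℕ → ℝ) (k : ℕ) : cumSum p k = cumSumPred p k + p k := by
  rw [cumSum, cumSumPred, ← Finset.Iio_insert, Finset.sum_insert (by simp), add_comm]

theorem cumSum_le_cumSumPred (hp : IsPmf p) {j k : ℕ} (h : j < k) :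
    cumSum p j ≤ cumSumPred p k :=
  Finset.sum_le_sum_of_subset_of_nonneg (fun i hi => by simp at *; omega) fun k _ _ => hp.1 k

theorem cumSum_mem_Icc (hp : IsPmf p) (k : ℕ) : cumSum p k ∈ Set.Icc (0 : ℝ) 1 :=
  ⟨Finset.sum_nonneg fun j _ => hp.1 j, sum_le_hasSum _ (fun j _ => hp.1 j) hp.2⟩

theorem cumSumPred_mem_Icc (hp : IsPmf p) (k : ℕ) : cumSumPred p k ∈ Set.Icc (0 : ℝ) 1 :=
  ⟨Finset.sum_nonneg fun j _ => hp.1 j, sum_le_hasSum _ (fun j _ => hp.1 j) hp.2⟩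

variable {Ω : Type*} [MeasurableSpace Ω] {P : Measure Ω} {U : ℝ → Ω → ℝ}

theorem IsBrownianBridge.memLp_two (hU : IsBrownianBridge U P) {t : ℝ}
    (ht : t ∈ Set.Icc (0 : ℝ) 1) : MemLp (U t) 2 P :=
  (hU.isGaussianProcess.hasGaussianLaw_eval ⟨t, ht⟩).memLp_two

theorem IsBrownianBridge.memLp_bridgeIncrement (hU : IsBrownianBridge U P) (hp : IsPmf p)
    (k : Fin (S + 2)) : MemLp (fun ω => bridgeIncrement p S (fun t => U t ω) k) 2 P :=
  (hU.memLp_two (cumSum_mem_Icc hp k)).sub (hU.memLp_two (cumSumPred_mem_Icc hp k))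

theorem IsBrownianBridge.aemeasurable_bridgeIncrement (hU : IsBrownianBridge U P)
    (hp : IsPmf p) : AEMeasurable (fun ω => bridgeIncrement p S (fun t => U t ω)) P :=
  aemeasurable_pi_lambda _ fun k => (hU.memLp_bridgeIncrement hp k).aemeasurable

theorem IsBrownianBridge.integral_bridgeIncrement [IsProbabilityMeasure P]
    (hU : IsBrownianBridge U P) (hp : IsPmf p) (k : Fin (S + 2)) :
    ∫ ω, bridgeIncrement p S (fun t => U t ω) k ∂P = 0 := by
  simp only [bridgeIncrement]
  rw [integral_sub ((hU.memLp_two (cumSum_mem_Icc hp k)).integrable (by norm_num))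
    ((hU.memLp_two (cumSumPred_mem_Icc hp k)).integrable (by norm_num)),
    hU.integral_eq_zero _ (cumSum_mem_Icc hp k), hU.integral_eq_zero _ (cumSumPred_mem_Icc hp k),
    sub_zero]

/-- The increments of the bridge have the covariance of a multinomial vector. -/
theorem IsBrownianBridge.covariance_bridgeIncrement [IsProbabilityMeasure P]
    (hU : IsBrownianBridge U P) (hp : IsPmf p) (j k : Fin (S + 2)) :
    covariance (fun ω => bridgeIncrement p S (fun t => U t ω) j)
      (fun ω => bridgeIncrement p S (fun t => U t ω) k) P
      = (if j = k then p j else 0) - p j * p k := by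
  simp only [bridgeIncrement]
  have h1 := cumSum_mem_Icc hp j
  have h2 := cumSumPred_mem_Icc hp j
  have h3 := cumSum_mem_Icc hp k
  have h4 := cumSumPred_mem_Icc hp k
  rw [covariance_fun_sub_fun_sub (hU.memLp_two h1) (hU.memLp_two h2) (hU.memLp_two h3)
    (hU.memLp_two h4), hU.covariance_eq _ h1 _ h3, hU.covariance_eq _ h1 _ h4,
    hU.covariance_eq _ h2 _ h3, hU.covariance_eq _ h2 _ h4]
  have ej := cumSum_eq_cumSumPred_add p j
  have ek := cumSum_eq_cumSumPred_add p k
  have pj := hp.1 j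
  have pk := hp.1 k
  rcases lt_trichotomy j k with h | rfl | h
  · have hle := cumSum_le_cumSumPred hp (show (j : ℕ) < k from h)
    rw [if_neg h.ne, min_eq_left (by linarith), min_eq_left (by linarith),
      min_eq_left (by linarith), min_eq_left (by linarith), ej, ek]
    ring
  · rw [if_pos rfl, min_self, min_self, min_eq_right (by linarith), min_eq_left (by linarith), ej]
    ring
  · have hle := cumSum_le_cumSumPred hp (show (k : ℕ) < j from h)
    rw [if_neg h.ne', min_eq_right (by linarith), min_eq_right (by linarith),
      min_eq_right (by linarith), min_eq_right (by linarith), ej, ek]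
    ring

/-- The variance of `∑ k, t k * 1{X = k}` for `X` with pmf `p`, i.e. the quadratic form of the
multinomial covariance matrix `diag p - p pᵀ` at `t`. -/
noncomputable def multinomialVariance (p : ℕ → ℝ) {N : ℕ} (t : Fin N → ℝ) : ℝ :=
  ∑ k, t k ^ 2 * p k - (∑ k, t k * p k) ^ 2

theorem IsBrownianBridge.hasLaw_sum_mul_bridgeIncrement [IsProbabilityMeasure P]
    (hU : IsBrownianBridge U P) (hp : IsPmf p) (t : Fin (S + 2) → ℝ) :
    HasLaw (fun ω => ∑ k, t k * bridgeIncrement p S (fun t => U t ω) k)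
      (gaussianReal 0 (multinomialVariance p t).toNNReal) P := by
  classical
  have hW := fun k => hU.memLp_bridgeIncrement (S := S) hp k
  have hG : HasGaussianLaw
      (fun ω => ∑ k, t k * bridgeIncrement p S (fun t => U t ω) k) P := by
    let F : Fin (S + 2) → Set.Icc (0 : ℝ) 1 := fun k => ⟨_, cumSum_mem_Icc hp k⟩
    let F' : Fin (S + 2) → Set.Icc (0 : ℝ) 1 := fun k => ⟨_, cumSumPred_mem_Icc hp k⟩
    let I : Finset (Set.Icc (0 : ℝ) 1) := Finset.univ.image F ∪ Finset.univ.image F'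
    have hF : ∀ k, F k ∈ I := fun k => by simp [I]
    have hF' : ∀ k, F' k ∈ I := fun k => by simp [I]
    let L : (I → ℝ) →L[ℝ] ℝ := ∑ k, t k •
      (ContinuousLinearMap.proj (R := ℝ) (φ := fun _ : I => ℝ) ⟨F k, hF k⟩
        - ContinuousLinearMap.proj (R := ℝ) (φ := fun _ : I => ℝ) ⟨F' k, hF' k⟩)
    have := (hU.isGaussianProcess.hasGaussianLaw I).map_fun L
    simpa [L, F, F', bridgeIncrement] using this
  have hmean : ∫ ω, ∑ k, t k * bridgeIncrement p S (fun t => U t ω) k ∂P = 0 := by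
    rw [integral_finsetSum _ fun k _ => ((hW k).integrable (by norm_num)).const_mul _]
    refine Finset.sum_eq_zero fun k _ => ?_
    rw [integral_const_mul, hU.integral_bridgeIncrement hp, mul_zero]
  have hvar : Var[fun ω => ∑ k, t k * bridgeIncrement p S (fun t => U t ω) k; P]
      = multinomialVariance p t := by
    rw [← covariance_self hG.aemeasurable,
      covariance_fun_sum_fun_sum (fun k => (hW k).const_mul _) (fun k => (hW k).const_mul _)]
    simp only [covariance_const_mul_left, covariance_const_mul_right,
      hU.covariance_bridgeIncrement hp, mul_sub, Finset.sum_sub_distrib]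
    simp only [multinomialVariance, mul_ite, mul_zero, Finset.sum_ite_eq, Finset.mem_univ, if_true]
    congr 1
    · exact Finset.sum_congr rfl fun k _ => by ring
    · rw [sq, Finset.sum_mul_sum]
      exact Finset.sum_congr rfl fun i _ => Finset.sum_congr rfl fun j _ => by ring
  refine ⟨hG.aemeasurable, ?_⟩
  rw [hG.map_eq_gaussianReal, hmean, hvar]

end Bridge

/-! ### The central limit theorem for the empirical pmf -/

section Empirical

variable {Ω : Type*} [MeasurableSpace Ω] {P : Measure Ω} [IsProbabilityMeasure P]
  {p : ℕ → ℝ} {X : ℕ → Ω → ℕ}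

/-- The linear combination `∑ k, t k * 1{x = k}` of indicators. -/
noncomputable def indicatorSum {N : ℕ} (t : Fin N → ℝ) (x : ℕ) : ℝ :=
  ∑ k : Fin N, t k * if x = k then 1 else 0

theorem indicatorSum_sq {N : ℕ} (t : Fin N → ℝ) (x : ℕ) :
    indicatorSum t x ^ 2 = indicatorSum (fun k => t k ^ 2) x := by
  rw [indicatorSum, sq, Finset.sum_mul_sum, indicatorSum]
  refine Finset.sum_congr rfl fun i _ => ?_
  rw [Finset.sum_eq_single i]
  · split_ifs <;> ring
  · intro j _ hj
    have : (j : ℕ) ≠ i := fun h => hj (Fin.ext h)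
    split_ifs <;> first | omega | simp
  · simp

theorem memLp_indicatorSum {N : ℕ} (t : Fin N → ℝ) {Y : Ω → ℕ} (hY : Measurable Y) (q : ℝ≥0∞) :
    MemLp (fun ω => indicatorSum t (Y ω)) q P := by
  refine MemLp.of_bound
    ((measurable_from_top (f := indicatorSum t)).comp hY).aestronglyMeasurable (∑ k, |t k|)
    (ae_of_all _ fun ω => ?_)
  rw [Real.norm_eq_abs]
  refine (Finset.abs_sum_le_sum_abs _ _).trans (Finset.sum_le_sum fun k _ => ?_)
  split_ifs <;> simp

theorem integral_indicatorSum {N : ℕ} (t : Fin N → ℝ) {Y : Ω → ℕ} (hY : Measurable Y)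
    (hlaw : ∀ k, P.real {ω | Y ω = k} = p k) :
    ∫ ω, indicatorSum t (Y ω) ∂P = ∑ k, t k * p k := by
  have hm : ∀ k : ℕ, MeasurableSet {ω | Y ω = k} := fun k => hY (measurableSet_singleton k)
  have e : ∀ k : ℕ, (fun ω => if Y ω = k then (1 : ℝ) else 0)
      = Set.indicator {ω | Y ω = k} 1 := by
    intro k
    ext ω
    simp [Set.indicator_apply]
  simp only [indicatorSum]
  rw [integral_finsetSum]
  · refine Finset.sum_congr rfl fun k _ => ?_
    rw [integral_const_mul, e, integral_indicator_one (hm k), hlaw]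
  · intro k _
    refine Integrable.const_mul ?_ _
    rw [e]
    exact (integrable_const (1 : ℝ)).indicator (hm k)

theorem variance_indicatorSum {N : ℕ} (t : Fin N → ℝ) {Y : Ω → ℕ} (hY : Measurable Y)
    (hlaw : ∀ k, P.real {ω | Y ω = k} = p k) :
    Var[fun ω => indicatorSum t (Y ω); P] = multinomialVariance p t := by
  rw [variance_eq_sub (memLp_indicatorSum t hY 2), integral_indicatorSum t hY hlaw]
  simp only [Pi.pow_apply, indicatorSum_sq]
  rw [integral_indicatorSum _ hY hlaw, multinomialVariance]

theorem sum_mul_empiricalPmf {n N : ℕ} (x : Fin n → ℕ) (t : Fin N → ℝ) :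
    ∑ k, t k * empiricalPmf x k = (n : ℝ)⁻¹ * ∑ i, indicatorSum t (x i) := by
  simp only [empiricalPmf, indicatorSum, one_div]
  rw [Finset.sum_comm, Finset.mul_sum]
  refine Finset.sum_congr rfl fun k _ => ?_
  rw [← Finset.mul_sum]
  ring

theorem identDistrib_of_law (hXmeas : ∀ i, Measurable (X i))
    (hlaw : ∀ i k, P.real {ω | X i ω = k} = p k) (i : ℕ) : IdentDistrib (X i) (X 0) P P := by
  refine ⟨(hXmeas i).aemeasurable, (hXmeas 0).aemeasurable, ?_⟩
  refine Measure.ext_of_singleton fun k => ?_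
  rw [Measure.map_apply (hXmeas i) (measurableSet_singleton k),
    Measure.map_apply (hXmeas 0) (measurableSet_singleton k)]
  have := (hlaw i k).trans (hlaw 0 k).symm
  exact (measureReal_eq_measureReal_iff).1 this

/-- Statistics of the first `n` observations are measurable, `ℕ ^ n` being countable. -/
theorem measurable_statistic {E : Type*} [MeasurableSpace E] (hXmeas : ∀ i, Measurable (X i))
    {n : ℕ} (f : (Fin n → ℕ) → E) : Measurable fun ω => f fun i : Fin n => X i ω :=
  (measurable_of_countable f).comp (measurable_pi_lambda _ fun i => hXmeas i)

/-- The multinomial central limit theorem, with the limit written as increments of a Brownian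
bridge. -/
theorem tendstoInDistribution_empiricalPmf {Ω' : Type*} [MeasurableSpace Ω'] {P' : Measure Ω'}
    [IsProbabilityMeasure P'] {U : ℝ → Ω' → ℝ} (hU : IsBrownianBridge U P') (hp : IsPmf p)
    (S : ℕ) (hXmeas : ∀ i, Measurable (X i)) (hXindep : iIndepFun X P)
    (hlaw : ∀ i k, P.real {ω | X i ω = k} = p k) :
    TendstoInDistribution
      (fun (n : ℕ) (ω : Ω) (k : Fin (S + 2)) =>
        √(n : ℝ) * (empiricalPmf (fun i : Fin n => X i ω) k - p k))
      atTop (fun ω => bridgeIncrement p S (fun t => U t ω)) (fun _ => P) P' := by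
  refine tendstoInDistribution_of_forall_linear
    (fun n => (measurable_statistic hXmeas fun x (k : Fin (S + 2)) =>
      √(n : ℝ) * (empiricalPmf x k - p k)).aemeasurable)
    (hU.aemeasurable_bridgeIncrement hp) fun t => ?_
  have hmeas : Measurable (indicatorSum t) := measurable_from_top
  have hlawW := hU.hasLaw_sum_mul_bridgeIncrement hp t
  rw [← variance_indicatorSum t (hXmeas 0) (hlaw 0)] at hlawW
  have := tendstoInDistribution_inv_sqrt_mul_sum_sub (P := P)
    (X := fun i ω => indicatorSum t (X i ω)) hlawW (memLp_indicatorSum t (hXmeas 0) 2)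
    (hXindep.comp (fun _ => indicatorSum t) fun _ => hmeas)
    (fun i => (identDistrib_of_law hXmeas hlaw i).comp hmeas)
  refine this.congr (fun n => Eventually.of_forall fun ω => ?_) (EventuallyEq.refl _ _)
  have e : ∑ k, t k * (√(n : ℝ) * (empiricalPmf (fun i : Fin n => X i ω) k - p k))
      = √(n : ℝ) * (∑ k, t k * empiricalPmf (fun i : Fin n => X i ω) k - ∑ k, t k * p k) := by
    rw [← Finset.sum_sub_distrib, Finset.mul_sum]
    exact Finset.sum_congr rfl fun k _ => by ring
  simp only
  rw [e, sum_mul_empiricalPmf, integral_indicatorSum t (hXmeas 0) (hlaw 0), Finset.sum_range]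
  -- for an empty sample both sides vanish, by the conventions for `√0` and `0⁻¹`
  rcases n.eq_zero_or_pos with rfl | hn
  · simp
  · have hn' : (0 : ℝ) < n := by exact_mod_cast hn
    have hs : √(n : ℝ) ^ 2 = n := Real.sq_sqrt hn'.le
    have hs0 : √(n : ℝ) ≠ 0 := (Real.sqrt_pos.2 hn').ne'
    generalize √(n : ℝ) = s at *
    rw [← hs]
    field_simp

/-- Strong consistency of the empirical pmf at each point. -/
theorem tendsto_empiricalPmf_ae (hXmeas : ∀ i, Measurable (X i)) (hXindep : iIndepFun X P)
    (hlaw : ∀ i k, P.real {ω | X i ω = k} = p k) :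
    ∀ᵐ ω ∂P, ∀ k, Tendsto (fun n : ℕ => empiricalPmf (fun i : Fin n => X i ω) k)
      atTop (𝓝 (p k)) := by
  refine ae_all_iff.2 fun k => ?_
  let f : ℕ → ℝ := fun x => if x = k then 1 else 0
  have hf : Measurable f := measurable_from_top
  have hm : MeasurableSet {ω | X 0 ω = k} := hXmeas 0 (measurableSet_singleton k)
  have e : (fun ω => f (X 0 ω)) = Set.indicator {ω | X 0 ω = k} 1 := by
    ext ω
    simp [f, Set.indicator_apply]
  have hint : Integrable (fun ω => f (X 0 ω)) P := by
    rw [e]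
    exact (integrable_const (1 : ℝ)).indicator hm
  have hmean : ∫ ω, f (X 0 ω) ∂P = p k := by
    rw [e, integral_indicator_one hm, hlaw]
  have := strong_law_ae_real (fun i ω => f (X i ω)) hint
    (fun i j hij => (hXindep.indepFun hij).comp hf hf)
    (fun i => (identDistrib_of_law hXmeas hlaw i).comp hf)
  filter_upwards [this] with ω hω
  rw [hmean] at hω
  refine hω.congr fun n => ?_
  rw [empiricalPmf, Finset.sum_range, div_eq_inv_mul, one_div]

theorem ae_forall_le_of_law {S : ℕ} (hp : ∀ k, S < k → p k = 0)
    (hlaw : ∀ i k, P.real {ω | X i ω = k} = p k) : ∀ᵐ ω ∂P, ∀ i, X i ω ≤ S := by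
  refine ae_all_iff.2 fun i => ?_
  have : ∀ᵐ ω ∂P, ∀ k, S < k → X i ω ≠ k := by
    refine ae_all_iff.2 fun k => ?_
    by_cases hk : S < k
    · have h0 : P {ω | X i ω = k} = 0 := by
        rw [← measureReal_eq_zero_iff, hlaw, hp k hk]
      filter_upwards [measure_eq_zero_iff_ae_notMem.1 h0] with ω hω _ h
      exact hω h
    · exact ae_of_all _ fun ω h => absurd h hk
  filter_upwards [this] with ω hω
  by_contra h
  exact hω _ (not_le.1 h) rfl

end Empirical

/-! ### Convergence in distribution of the estimator -/

theorem cumSum_fin {N : ℕ} (p : ℕ → ℝ) (k : Fin N) :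
    cumSum (fun j : Fin N => p j) k = cumSum p (k : ℕ) := by
  rw [cumSum, cumSum, ← Fin.map_valEmbedding_Iic, Finset.sum_map]
  rfl

theorem cumCumSum_fin {N : ℕ} (p : ℕ → ℝ) (k : Fin N) :
    cumCumSum (fun j : Fin N => p j) k = cumCumSum p (k : ℕ) := by
  rw [cumCumSum, cumCumSum, ← Fin.map_valEmbedding_Iio, Finset.sum_map]
  exact Finset.sum_congr rfl fun j _ => cumSum_fin p j

/-- The triple `(H_g, F_g, g)` attached to a vector `g`. -/
def cumTriple {N : ℕ} (g : Fin N → ℝ) : (Fin N → ℝ) × (Fin N → ℝ) × (Fin N → ℝ) :=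
  (cumCumSum g, cumSum g, g)

theorem continuous_cumTriple {N : ℕ} : Continuous (cumTriple (N := N)) := by
  have h1 : Continuous fun g : Fin N → ℝ => cumSum g :=
    continuous_pi fun k => by unfold cumSum; fun_prop
  have h2 : Continuous fun g : Fin N → ℝ => cumCumSum g :=
    continuous_pi fun k => continuous_finsetSum _ fun j _ => (continuous_apply j).comp h1
  exact h2.prodMk (h1.prodMk continuous_id)

theorem cumTriple_const_mul_sub {N : ℕ} (c : ℝ) (p q : ℕ → ℝ) :
    cumTriple (fun k : Fin N => c * (p k - q k))
      = (fun k : Fin N => c * (cumCumSum p (k : ℕ) - cumCumSum q (k : ℕ)),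
          fun k : Fin N => c * (cumSum p (k : ℕ) - cumSum q (k : ℕ)),
          fun k : Fin N => c * (p k - q k)) := by
  have h1 : ∀ k : ℕ, cumSum (fun j : ℕ => c * (p j - q j)) k = c * (cumSum p k - cumSum q k) := by
    intro k
    simp only [cumSum, ← Finset.mul_sum, Finset.sum_sub_distrib]
  have h2 : ∀ k : ℕ, cumCumSum (fun j : ℕ => c * (p j - q j)) k
      = c * (cumCumSum p k - cumCumSum q k) := by
    intro k
    simp only [cumCumSum, h1, ← Finset.mul_sum, Finset.sum_sub_distrib]
  refine Prod.ext (funext fun k => ?_) (Prod.ext (funext fun k => ?_) rfl)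
  · exact (cumCumSum_fin (fun j => c * (p j - q j)) k).trans (h2 k)
  · exact (cumSum_fin (fun j => c * (p j - q j)) k).trans (h1 k)

/-- Almost surely, from some sample size on, the normalized error of the estimator is the projection
of the normalized error of the empirical pmf. -/
theorem ae_eventually_convexLSE_eq {Ω : Type*} [MeasurableSpace Ω] {P : Measure Ω}
    [IsProbabilityMeasure P] {S : ℕ} {p₀ : ℕ → ℝ} (hconv : IsConvexSeq p₀)
    (hp : ∀ k, S < k → p₀ k = 0) (hpS : 0 < p₀ S) {X : ℕ → Ω → ℕ}
    (hXmeas : ∀ i, Measurable (X i)) (hXindep : iIndepFun X P)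
    (hXlaw : ∀ i k, P.real {ω | X i ω = k} = p₀ k) :
    ∀ᵐ ω ∂P, ∀ᶠ n : ℕ in atTop,
      (fun k : Fin (S + 2) => √(n : ℝ) * (convexLSE (fun i : Fin n => X i ω) k - p₀ k))
        = piecewiseConvexProj S (interiorKnots p₀ S) (fun k =>
            √(n : ℝ) * (empiricalPmf (fun i : Fin n => X i ω) k - p₀ k)) := by
  obtain ⟨δ, hδ0, hδ⟩ := exists_laplacian_gap p₀ S
  filter_upwards [tendsto_empiricalPmf_ae hXmeas hXindep hXlaw, ae_forall_le_of_law hp hXlaw]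
    with ω hω hle
  have hlim : Tendsto (fun n : ℕ => ∑ k : Fin (S + 2),
      (empiricalPmf (fun i : Fin n => X i ω) k - p₀ k) ^ 2) atTop (𝓝 0) := by
    have := tendsto_finsetSum (Finset.univ : Finset (Fin (S + 2)))
      fun k _ => ((hω k).sub_const (p₀ k)).pow 2
    simpa using this
  filter_upwards [hlim.eventually_le_const (show 0 < δ ^ 2 by positivity)] with n hn
  have h := piecewiseConvexProj_smul (S := S) (K := interiorKnots p₀ S) (Real.sqrt_nonneg n)
    (fun k => empiricalPmf (fun i : Fin n => X i ω) k - p₀ k)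
  refine Eq.trans (funext fun k => ?_) h.symm
  rw [convexLSE_sub_eq_piecewiseConvexProj hconv hp hpS hδ0.le hδ (fun i => hle i) hn]
  rfl

end ConvexPmf

theorem theorem4
    {Ω : Type*} [MeasurableSpace Ω] (P : Measure Ω) [IsProbabilityMeasure P]
    {Ω' : Type*} [MeasurableSpace Ω'] (P' : Measure Ω') [IsProbabilityMeasure P']
    (S : ℕ) (p₀ : ℕ → ℝ)
    (hpmf : ConvexPmf.IsPmf p₀) (hconv : ConvexPmf.IsConvexSeq p₀)
    (hsupp : Function.support p₀ = Set.Iic S)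
    (X : ℕ → Ω → ℕ) (hXmeas : ∀ i, Measurable (X i)) (hXindep : iIndepFun X P)
    (hXlaw : ∀ i k, P.real {ω | X i ω = k} = p₀ k)
    (U : ℝ → Ω' → ℝ) (hU : ConvexPmf.IsBrownianBridge U P')
    (phat : ℕ → Ω → ℕ → ℝ)
    (hphat : ∀ n ω, phat n ω = ConvexPmf.convexLSE (fun i : Fin n => X i ω))
    (ghat : Ω' → Fin (S + 2) → ℝ)
    (hghat : ∀ ω, ghat ω = ConvexPmf.piecewiseConvexProj S (ConvexPmf.interiorKnots p₀ S)
      (ConvexPmf.bridgeIncrement p₀ S (fun t => U t ω))) :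
    TendstoInDistribution
      (fun (n : ℕ) (ω : Ω) =>
        ((fun k : Fin (S + 2) => √(n : ℝ) *
            (ConvexPmf.cumCumSum (phat n ω) k - ConvexPmf.cumCumSum p₀ k),
          fun k : Fin (S + 2) => √(n : ℝ) *
            (ConvexPmf.cumSum (phat n ω) k - ConvexPmf.cumSum p₀ k),
          fun k : Fin (S + 2) => √(n : ℝ) * (phat n ω k - p₀ k)) :
          (Fin (S + 2) → ℝ) × (Fin (S + 2) → ℝ) × (Fin (S + 2) → ℝ)))
      atTop
      (fun ω => (ConvexPmf.cumCumSum (ghat ω), ConvexPmf.cumSum (ghat ω), ghat ω))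
      (fun _ => P) P' := by
  have hp : ∀ k, S < k → p₀ k = 0 := fun k hk =>
    Function.notMem_support.1 (by rw [hsupp]; simpa using hk)
  have hpS : 0 < p₀ S := by
    refine lt_of_le_of_ne (hpmf.1 S) (Ne.symm ?_)
    have : S ∈ Function.support p₀ := by rw [hsupp]; exact Set.mem_Iic.2 le_rfl
    exact this
  have hclt := (ConvexPmf.tendstoInDistribution_empiricalPmf hU hpmf S hXmeas hXindep
    hXlaw).continuous_comp (ConvexPmf.continuous_cumTriple.comp
      (ConvexPmf.continuous_piecewiseConvexProj (K := ConvexPmf.interiorKnots p₀ S)))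
  have hlim : (fun ω => (ConvexPmf.cumCumSum (ghat ω), ConvexPmf.cumSum (ghat ω), ghat ω))
      = (ConvexPmf.cumTriple ∘ ConvexPmf.piecewiseConvexProj S (ConvexPmf.interiorKnots p₀ S))
        ∘ fun ω => ConvexPmf.bridgeIncrement p₀ S (fun t => U t ω) := by
    funext ω
    rw [hghat]
    rfl
  simp only [← ConvexPmf.cumTriple_const_mul_sub, hphat, hlim]
  have hmeas : ∀ n : ℕ, Measurable fun ω => ConvexPmf.cumTriple fun k : Fin (S + 2) =>
      √(n : ℝ) * (ConvexPmf.convexLSE (fun i : Fin n => X i ω) k - p₀ k) := fun n =>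
    ConvexPmf.measurable_statistic hXmeas fun x => ConvexPmf.cumTriple fun k : Fin (S + 2) =>
      √(n : ℝ) * (ConvexPmf.convexLSE x k - p₀ k)
  refine tendstoInDistribution_of_tendstoInMeasure_sub _ _ hclt ?_
    fun n => (hmeas n).aemeasurable
  refine tendstoInMeasure_of_tendsto_ae
    (fun n => ((hmeas n).aemeasurable.sub (hclt.forall_aemeasurable n)).aestronglyMeasurable) ?_
  filter_upwards [ConvexPmf.ae_eventually_convexLSE_eq hconv hp hpS hXmeas hXindep hXlaw]
    with ω hω
  -- the difference vanishes from some sample size on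
  refine tendsto_const_nhds.congr' ?_
  filter_upwards [hω] with n hn
  simp only [Pi.sub_apply, Function.comp_apply, hn, sub_self, Pi.zero_apply]
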